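/- Let $n\ge 1$. An ascent sequence of length $n$ is a sequence $\mathbf a=(a_1,\dots,a_n)$ of non-negative integers with $a_1=0$ and $a_i\le \mathrm{asc}(a_1,\dots,a_{i-1})+1$ for $1<i\le n$, where $\mathrm{asc}(b_1,\dots,b_k)$ is the number of $j\in\{1,\dots,k-1\}$ with $b_j<b_{j+1}$. Let $\mathsf{CAsc}_n$ be the set of ascent sequences of length $n$ that avoid the pattern $101$, i.e. for which there are no $i<j<k$ with $a_i=a_k>a_j$. For a finite poset $P$ and $x\in P$ let $D(x)=\{y\in P: y<x\}$. If $P$ is $(2+2)$-free (has no induced subposet isomorphic to a disjoint union of two 2-element chains), the distinct sets $D(x)$ form a chain $\emptyset=D_0\subsetneq D_1\subsetneq\dots\subsetneq D_{\ell(P)}$; an element $x$ with $D(x)=D_i$ is said to lie at level $i$. Let $\ell^\star(P)$ be the least level that contains a maximal element of $P$. To an ascent sequence $\mathbf a=(a_1,\dots,a_n)$ associate a poset $f_{AP}(\mathbf a)=P^{(n)}$, considered up to isomorphism, as follows. $P^{(1)}$ is the one-element poset. For $1\le k<n$, the poset $P^{(k+1)}$ is obtained from $P=P^{(k)}$ by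 adding one new element $p$: 1. if $0\le a_{k+1}\le \ell^\star(P)$, then $p$ is a new maximal element whose strict downset is $D_{a_{k+1}}$; 2. if $a_{k+1}=\ell(P)+1$, then $p$ is placed above all elements of $P$; 3. if $\ell^\star(P)<a_{k+1}\le \ell(P)$, then $p$ is a new maximal element with strict downset $D_{a_{k+1}}$, and in addition one adds all relations $x<y$ where $x$ is a maximal element of $P$ at a level less than $a_{k+1}$ and $y$ is an element of $P$ at a level at least $a_{k+1}$ (levels taken in $P$). Let $\mathsf{CPosets}_n$ be the set of isomorphism classes of $n$-element posets that are $(2+2)$-free and $N$-free, i.e. that also have no induced subposet on four elements $e,f,g,h$ whose strict relations are exactly $e<h$, $f<h$, $f<g$ (the series-parallel $(2+2)$-free posets). Then $f_{AP}$ restricts to a bijection $\mathsf{CAsc}_n\to\mathsf{CPosets}_n$: it maps $\mathsf{CAsc}_n$ into $\mathsf{CPosets}_n$, is injective on $\mathsf{CAsc}_n$, and every element of $\mathsf{CPosets}_n$ is the image of an element of $\mathsf{CAsc}_n$. -/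

import Mathlib

namespace AscPoset

/-! ### Sequences of non-negative integers -/

/-- The number of ascents of a finite sequence: positions `j` with `b_j < b_{j+1}`. -/
noncomputable def asc {k : ℕ} (b : Fin k → ℕ) : ℕ :=
  {j : ℕ | ∃ h : j + 1 < k, b ⟨j, Nat.lt_of_succ_lt h⟩ < b ⟨j + 1, h⟩}.ncard

/-- The truncated sequence consisting of the entries strictly before position `i`. -/
def before {n : ℕ} (a : Fin n → ℕ) (i : Fin n) : Fin i.1 → ℕ :=
  fun j => a (Fin.castLE i.2.le j)

/-- Ascent sequences: the first entry is `0`, and every later entry is at most one more than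
the number of ascents of the sequence of all the entries before it. -/
def IsAscentSeq {n : ℕ} (a : Fin n → ℕ) : Prop :=
  (∀ i : Fin n, i.1 = 0 → a i = 0) ∧
  (∀ i : Fin n, 0 < i.1 → a i ≤ asc (before a i) + 1)

/-- `a` contains `b` as a pattern: some subsequence of `a` is in the same relative order as `b`
(the equivalence for both `(s, t)` and `(t, s)` covers equal entries too). -/
def ContainsPattern {r s : ℕ} (a : Fin r → ℕ) (b : Fin s → ℕ) : Prop :=
  ∃ f : Fin s → Fin r, StrictMono f ∧ ∀ i j : Fin s, a (f i) < a (f j) ↔ b i < b j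

/-- The set of `101`-avoiding ascent sequences of length `n`. -/
def CAsc (n : ℕ) : Set (Fin n → ℕ) :=
  {a | IsAscentSeq a ∧ ¬ ContainsPattern a ![1, 0, 1]}

/-! ### Posets -/

/-- Two posets are isomorphic. -/
def Isom {α β : Type} (P : PartialOrder α) (Q : PartialOrder β) : Prop :=
  Nonempty (α ≃o β)

/-- Isomorphism of partial orders on the label set `Fin n`. -/
def isomSetoid (n : ℕ) : Setoid (PartialOrder (Fin n)) where
  r P Q := Isom P Q
  iseqv :=
    { refl := fun P => ⟨@OrderIso.refl (Fin n) P.toLE⟩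
      symm := fun {P Q} ⟨e⟩ => ⟨@OrderIso.symm _ _ P.toLE Q.toLE e⟩
      trans := fun {P Q R} ⟨e⟩ ⟨f⟩ => ⟨@OrderIso.trans _ _ _ P.toLE Q.toLE R.toLE e f⟩ }

/-- Unlabelled posets on `n` elements: isomorphism classes of partial orders on `Fin n`. -/
def UPoset (n : ℕ) : Type := Quotient (isomSetoid n)

/-- The isomorphism class of a labelled poset. -/
def unlabel {n : ℕ} (P : PartialOrder (Fin n)) : UPoset n := Quotient.mk (isomSetoid n) P

/-- `x` and `y` are incomparable (in particular distinct). -/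
def Incomp {α : Type} (P : PartialOrder α) (x y : α) : Prop := ¬ x ≤ y ∧ ¬ y ≤ x

/-- No induced subposet is a disjoint union of two 2-element chains `e < f` and `g < h`. -/
def TwoPlusTwoFree {α : Type} (P : PartialOrder α) : Prop :=
  ¬ ∃ e f g h : α, e < f ∧ g < h ∧
    Incomp P e g ∧ Incomp P e h ∧ Incomp P f g ∧ Incomp P f h

/-- No induced subposet is the four-element poset N, whose strict relations are exactly
`e < h`, `f < h`, `f < g`. -/
def NFree {α : Type} (P : PartialOrder α) : Prop :=
  ¬ ∃ e f g h : α, e < h ∧ f < h ∧ f < g ∧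
    Incomp P e f ∧ Incomp P e g ∧ Incomp P g h

/-- Unlabelled posets on `n` elements that are both (2+2)-free and N-free. -/
def CPosets (n : ℕ) : Set (UPoset n) :=
  {X | ∃ P : PartialOrder (Fin n), TwoPlusTwoFree P ∧ NFree P ∧ unlabel P = X}

/-! ### Levels -/

/-- `ell P` is the number of distinct nonempty strict downsets `D(x) = Set.Iio x`. -/
noncomputable def ell {α : Type} (P : PartialOrder α) : ℕ :=
  {D : Set α | D ∈ Set.range (fun y : α => Set.Iio y) ∧ D.Nonempty}.ncard

/-- The level of `x`: the number of distinct strict downsets properly contained in `D(x)`. When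
the strict downsets form a chain `∅ = D_0 ⊂ D_1 ⊂ ⋯ ⊂ D_ℓ`, which is the case exactly for
(2+2)-free posets, this is the index `i` with `D(x) = D_i`. -/
noncomputable def level {α : Type} (P : PartialOrder α) (x : α) : ℕ :=
  {D : Set α | D ∈ Set.range (fun y : α => Set.Iio y) ∧ D ⊂ Set.Iio x}.ncard

/-- The minimum index of a level that contains a maximal element. -/
noncomputable def ellStar {α : Type} (P : PartialOrder α) : ℕ :=
  sInf {i : ℕ | ∃ x : α, IsMax x ∧ level P x = i}

theorem level_lt {α : Type} [Finite α] (P : PartialOrder α) {x y : α} (h : x < y) :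
    level P x < level P y := by
  have hss : Set.Iio x ⊂ Set.Iio y :=
    ⟨fun z hz => lt_trans hz h, fun hc => lt_irrefl x (hc h)⟩
  refine Set.ncard_lt_ncard ⟨?_, ?_⟩ (Set.toFinite _)
  · rintro D ⟨hD, hDx⟩
    exact ⟨hD, hDx.trans hss⟩
  · intro hc
    exact (hc ⟨⟨x, rfl⟩, hss⟩).2.ne rfl

/-! ### Adding elements and relations -/

/-- The poset obtained from `P` by adding a new maximal element `none`, whose strict downset is
the downward closed set `S`. -/
@[reducible] def addMax {α : Type} (P : PartialOrder α) (S : Set α) (hS : IsLowerSet S) :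
    PartialOrder (Option α) where
  le u v :=
    match u, v with
    | some x, some y => x ≤ y
    | some x, none => x ∈ S
    | none, some _ => False
    | none, none => True
  lt u v :=
    match u, v with
    | some x, some y => x < y
    | some x, none => x ∈ S
    | none, _ => False
  lt_iff_le_not_ge u v := by
    cases u <;> cases v
    · exact ⟨False.elim, fun h => h.2 trivial⟩
    · exact ⟨False.elim, fun h => h.1⟩
    · exact ⟨fun h => ⟨h, fun h' => h'⟩, fun h => h.1⟩
    · exact lt_iff_le_not_ge
  le_refl u := by
    cases u
    · trivial
    · exact le_refl _
  le_trans u v w := by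
    cases u <;> cases v <;> cases w <;> intro h₁ h₂
    all_goals first
      | trivial
      | exact h₁.elim
      | exact h₂.elim
      | exact le_trans h₁ h₂
      | exact hS h₁ h₂
  le_antisymm u v := by
    cases u <;> cases v <;> intro h₁ h₂
    all_goals first
      | rfl
      | exact h₁.elim
      | exact h₂.elim
      | exact congrArg some (le_antisymm h₁ h₂)

/-- The set `D_a` of the elements below the elements of level `a`. -/
def belowLevel {α : Type} (P : PartialOrder α) (a : ℕ) : Set α :=
  {y | ∃ z : α, level P z = a ∧ y < z}

theorem belowLevel_isLowerSet {α : Type} (P : PartialOrder α) (a : ℕ) :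
    IsLowerSet (belowLevel P a) := by
  rintro x y hyx ⟨z, hz, hxz⟩
  exact ⟨z, hz, lt_of_le_of_lt hyx hxz⟩

/-- The strict relations of `P`, together with `x < y` for all maximal elements `x` of `P` that
lie at a level less than `a` and all elements `y` that lie at level `a` or higher. -/
def liftRel {α : Type} (P : PartialOrder α) (a : ℕ) (x y : α) : Prop :=
  x < y ∨ ((IsMax x ∧ level P x < a) ∧ a ≤ level P y)

theorem liftRel_level_lt {α : Type} [Finite α] (P : PartialOrder α) {a : ℕ} {x y : α}
    (h : liftRel P a x y) : level P x < level P y := by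
  rcases h with h | ⟨⟨_, h₁⟩, h₂⟩
  · exact level_lt P h
  · exact lt_of_lt_of_le h₁ h₂

theorem liftRel_trans_level_lt {α : Type} [Finite α] (P : PartialOrder α) {a : ℕ} {x y : α}
    (h : Relation.TransGen (liftRel P a) x y) : level P x < level P y := by
  induction h with
  | single h => exact liftRel_level_lt P h
  | tail _ h ih => exact ih.trans (liftRel_level_lt P h)

/-- The poset on the same elements as `P` generated by the relations `liftRel P a`. -/
@[reducible] def liftPoset {α : Type} [Finite α] (P : PartialOrder α) (a : ℕ) : PartialOrder α where
  le x y := x = y ∨ Relation.TransGen (liftRel P a) x y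
  lt x y := Relation.TransGen (liftRel P a) x y
  lt_iff_le_not_ge x y := by
    constructor
    · intro h
      refine ⟨Or.inr h, ?_⟩
      rintro (rfl | h')
      · exact lt_irrefl _ (liftRel_trans_level_lt P h)
      · exact lt_irrefl _ (liftRel_trans_level_lt P (h.trans h'))
    · rintro ⟨rfl | h, h'⟩
      · exact absurd (Or.inl rfl) h'
      · exact h
  le_refl x := Or.inl rfl
  le_trans x y z := by
    rintro (rfl | h₁) (rfl | h₂)
    · exact Or.inl rfl
    · exact Or.inr h₂
    · exact Or.inr h₁
    · exact Or.inr (h₁.trans h₂)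
  le_antisymm x y := by
    rintro (rfl | h₁) (h₂ | h₂)
    · rfl
    · rfl
    · exact h₂.symm
    · exact absurd (liftRel_trans_level_lt P (h₁.trans h₂)) (lt_irrefl _)

theorem belowLevel_isLowerSet_lift {α : Type} [Finite α] (P : PartialOrder α) (a : ℕ) :
    @IsLowerSet α (liftPoset P a).toLE (belowLevel P a) := by
  rintro x y hyx ⟨z, hz, hxz⟩
  rcases hyx with rfl | h
  · exact ⟨z, hz, hxz⟩
  · refine ⟨z, hz, ?_⟩
    induction h using Relation.TransGen.head_induction_on with
    | single h =>
      rcases h with h | ⟨_, h⟩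
      · exact h.trans hxz
      · have := level_lt P hxz
        omega
    | head h _ ih =>
      rcases h with h | ⟨_, h⟩
      · exact h.trans ih
      · have := level_lt P ih
        omega

/-! ### From ascent sequences to posets -/

open Classical in
/-- One step of the construction: the element `none` is added to `P` according to the value `a`.

* If `a ≤ ℓ*(P)`, add a new maximal element with the same strict downset as the elements of
  level `a`.
* If `a = ℓ(P) + 1`, add a new element above all the elements of `P`.
* If `ℓ*(P) < a ≤ ℓ(P)`, add a new element with the same strict downset in `P` as the elements
  of level `a`, and put every maximal element of `P` of level less than `a` below every element
  of `P` of level at least `a`.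

(No other value of `a` arises from an ascent sequence.) -/
@[reducible] noncomputable def apStep {α : Type} [Finite α] (P : PartialOrder α) (a : ℕ) :
    PartialOrder (Option α) :=
  if a ≤ ellStar P then
    addMax P (belowLevel P a) (belowLevel_isLowerSet P a)
  else if a = ell P + 1 then
    addMax P Set.univ (fun _ _ _ _ => trivial)
  else
    addMax (liftPoset P a) (belowLevel P a) (belowLevel_isLowerSet_lift P a)

/-- The labelled poset built from a sequence: start with a one-element poset and read the
remaining entries one at a time. The element added when the entry at position `i` is read
carries the label `i`. -/
@[reducible] noncomputable def apLabelled : (n : ℕ) → (Fin n → ℕ) → PartialOrder (Fin n)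
  | 0, _ => inferInstance
  | 1, _ => inferInstance
  | k + 2, a =>
    @PartialOrder.lift (Fin (k + 2)) (Option (Fin (k + 1)))
      (apStep (apLabelled (k + 1) (fun i => a i.castSucc)) (a (Fin.last (k + 1))))
      finSuccEquivLast finSuccEquivLast.injective

/-- The map from ascent sequences of length `n` to unlabelled posets on `n` elements. -/
noncomputable def fAP (n : ℕ) (a : Fin n → ℕ) : UPoset n := unlabel (apLabelled n a)

end AscPoset

namespace AscPoset

/-! ### Noncrossing restricted growth functions -/

/-! A `101`-avoiding ascent sequence is the same as a noncrossing restricted growth function: its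
ascents end exactly at the first occurrences of the positive values, so `asc` is the maximum so far
and the ascent bound says that a new value is the maximum plus one (`mem_CAsc_iff`).

For such `a` the poset has a direct description. Attach to position `i` the interval from the first
occurrence of the value `a i` to `i`; then `i` lies below `j` when the interval of `i` ends before
that of `j` starts, which is `Prec a i j`. Levels are values, `ell` is the maximum and `ellStar` is
the last entry. Noncrossing forces a repeated value to be at most the last entry, so only rules 1
and 2 ever fire and both reproduce `Prec` (`apLabelled_eq`).

Interval orders are (2+2)-free, and an N would yield a `101`. Conversely, the last position is a
maximal element with smallest downset. For injectivity, an isomorphism can be adjusted by a swap of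
twins to fix it, and it is then deleted. For surjectivity, N-freeness makes such an element a twin
of another or a top element, which dictates the entry to append. -/

/-- Every value is preceded by all smaller values, and no entry lying between two equal entries
is smaller than them. -/
structure IsNoncrossingRGF {n : ℕ} (a : Fin n → ℕ) : Prop where
  exists_lt : ∀ i v, v < a i → ∃ j < i, a j = v
  le_of_between : ∀ i j k, i < j → j < k → a i = a k → a k ≤ a j

theorem not_containsPattern_iff {n : ℕ} (a : Fin n → ℕ) :
    ¬ ContainsPattern a ![1, 0, 1] ↔ ∀ i j k, i < j → j < k → a i = a k → a k ≤ a j := by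
  constructor
  · intro h i j k hij hjk hik
    by_contra hlt
    refine h ⟨![i, j, k], ?_, ?_⟩
    · intro r s hrs
      fin_cases r <;> fin_cases s <;> simp_all
      exact hij.trans hjk
    · intro r s
      fin_cases r <;> fin_cases s <;> simp_all
      all_goals omega
  · rintro h ⟨f, hf, hp⟩
    have h01 := hf (show (0 : Fin 3) < 1 by decide)
    have h12 := hf (show (1 : Fin 3) < 2 by decide)
    have p02 := hp 0 2
    have p20 := hp 2 0
    have p12 := hp 1 2
    have := h _ _ _ h01 h12
    simp at p02 p20 p12
    omega

/-- Reading off the upper entry matches the ascents with the values `1, …, M`. Two ascents to the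
same value would have a smaller entry between equal ones; and the first occurrence of a positive
value is an ascent, since an entry at least as large just before it would force an earlier
occurrence. -/
theorem asc_eq_of_isNoncrossingRGF {n : ℕ} {b : Fin n → ℕ} (hb : IsNoncrossingRGF b) {M : ℕ}
    (hM : ∃ i, b i = M) (hle : ∀ i, b i ≤ M) : asc b = M := by
  classical
  rw [asc]
  -- The default `0` is never taken on the set of ascents; it only makes the map total.
  have key : Set.BijOn (fun j : ℕ => if h : j + 1 < n then b ⟨j + 1, h⟩ else 0)
      {j : ℕ | ∃ h : j + 1 < n, b ⟨j, Nat.lt_of_succ_lt h⟩ < b ⟨j + 1, h⟩} (Set.Icc 1 M) := by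
    refine ⟨?_, ?_, ?_⟩
    · rintro j ⟨h, hj⟩
      have := hle ⟨j + 1, h⟩
      simp only [h, dite_true, Set.mem_Icc]
      omega
    · have aux : ∀ j k : ℕ, j < k → ∀ (hj : j + 1 < n) (hk : k + 1 < n),
          b ⟨k, Nat.lt_of_succ_lt hk⟩ < b ⟨k + 1, hk⟩ → b ⟨j + 1, hj⟩ ≠ b ⟨k + 1, hk⟩ := by
        intro j k hjk hj hk hlt heq
        rcases eq_or_lt_of_le (Nat.succ_le_of_lt hjk) with rfl | hjk'
        · simp only [Nat.succ_eq_add_one] at *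
          omega
        · have := hb.le_of_between ⟨j + 1, hj⟩ ⟨k, Nat.lt_of_succ_lt hk⟩ ⟨k + 1, hk⟩ hjk'
            (Nat.lt_succ_self k) heq
          omega
      rintro j ⟨hj, hja⟩ k ⟨hk, hka⟩ heq
      simp only [hj, hk, dite_true] at heq
      rcases lt_trichotomy j k with h | h | h
      · exact absurd heq (aux j k h hj hk hka)
      · exact h
      · exact absurd heq.symm (aux k j h hk hj hja)
    · rintro v ⟨hv1, hvM⟩
      obtain ⟨m, hm⟩ := hM
      have hex : ∃ i, b i = v := by
        rcases hvM.lt_or_eq with h | h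
        · obtain ⟨j, -, hj⟩ := hb.exists_lt m v (hm ▸ h)
          exact ⟨j, hj⟩
        · exact ⟨m, hm.trans h.symm⟩
      obtain ⟨i, hi, hmin⟩ := Set.exists_min_image {i | b i = v} id (Set.toFinite _) hex
      simp only [Set.mem_ofPred_eq, id] at hi hmin
      obtain ⟨i, hin⟩ := i
      cases i with
      | zero =>
        obtain ⟨j, hj, -⟩ := hb.exists_lt ⟨0, hin⟩ 0 (by omega)
        exact absurd hj (Nat.not_lt_zero _)
      | succ j =>
        refine ⟨j, ⟨hin, ?_⟩, by simp [hin, hi]⟩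
        by_contra hge
        have : ∃ k ≤ (⟨j, Nat.lt_of_succ_lt hin⟩ : Fin n), b k = v := by
          rcases (not_lt.mp hge).lt_or_eq with h | h
          · obtain ⟨k, hk, hkv⟩ := hb.exists_lt _ _ h
            exact ⟨k, hk.le, hkv.trans hi⟩
          · exact ⟨_, le_rfl, h.symm.trans hi⟩
        obtain ⟨k, hk, hkv⟩ := this
        have h1 := hmin k hkv
        simp only [Fin.le_def] at h1 hk
        omega
  rw [Set.ncard_congr (fun j _ => _) (fun j hj => key.mapsTo hj)
    (fun j k hj hk h => key.injOn hj hk h) (fun v hv => by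
      obtain ⟨j, hj, h⟩ := key.surjOn hv
      exact ⟨j, hj, h⟩)]
  rw [← Finset.coe_Icc, Set.ncard_coe_finset]
  simp

theorem exists_max {n : ℕ} (hn : 0 < n) (a : Fin n → ℕ) :
    ∃ M, (∃ i, a i = M) ∧ ∀ i, a i ≤ M := by
  obtain ⟨i, -, hi⟩ := Set.exists_max_image Set.univ a (Set.toFinite _) ⟨⟨0, hn⟩, trivial⟩
  exact ⟨a i, ⟨i, rfl⟩, fun j => hi j trivial⟩

theorem IsNoncrossingRGF.comp_castLE {m n : ℕ} {a : Fin n → ℕ} (ha : IsNoncrossingRGF a)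
    (h : m ≤ n) : IsNoncrossingRGF (fun i => a (Fin.castLE h i)) where
  exists_lt i v hv := by
    obtain ⟨j, hj, hjv⟩ := ha.exists_lt _ v hv
    exact ⟨⟨j, lt_trans hj i.2⟩, hj, hjv⟩
  le_of_between i j k hij hjk := ha.le_of_between _ _ _ hij hjk

/-- Strong induction on the position: once the prefix is a noncrossing restricted growth function
with maximum `M`, the ascent bound reads `a i ≤ M + 1`, and every value up to `M` has already
occurred. -/
theorem mem_CAsc_iff {n : ℕ} (a : Fin n → ℕ) : a ∈ CAsc n ↔ IsNoncrossingRGF a := by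
  constructor
  · rintro ⟨⟨h0, h1⟩, hp⟩
    rw [not_containsPattern_iff] at hp
    have key : ∀ m : ℕ, ∀ i : Fin n, i.1 = m → ∀ v, v < a i → ∃ j < i, a j = v := by
      intro m
      induction m using Nat.strong_induction_on with
      | _ m ih =>
        rintro i rfl v hv
        rcases Nat.eq_zero_or_pos i.1 with hi | hi
        · rw [h0 i hi] at hv
          omega
        · have hgood : IsNoncrossingRGF (before a i) := by
            refine ⟨fun j w hw => ?_, fun j k l hjk hkl => hp _ _ _ hjk hkl⟩
            obtain ⟨k, hk, hkw⟩ := ih j.1 j.2 (Fin.castLE i.2.le j) rfl w hw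
            exact ⟨⟨k, lt_trans hk j.2⟩, hk, hkw⟩
          obtain ⟨M, ⟨j, hj⟩, hle⟩ := exists_max hi (before a i)
          have := h1 i hi
          rw [asc_eq_of_isNoncrossingRGF hgood ⟨j, hj⟩ hle] at this
          rcases (show v ≤ M by omega).lt_or_eq with h | h
          · obtain ⟨k, hk, hkv⟩ := hgood.exists_lt j v (hj ▸ h)
            exact ⟨Fin.castLE i.2.le k, k.2, hkv⟩
          · exact ⟨Fin.castLE i.2.le j, j.2, hj.trans h.symm⟩
    exact ⟨fun i => key i.1 i rfl, hp⟩
  · intro ha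
    refine ⟨⟨fun i hi => ?_, fun i hi => ?_⟩, (not_containsPattern_iff a).2 ha.le_of_between⟩
    · by_contra h
      obtain ⟨j, hj, -⟩ := ha.exists_lt i 0 (by omega)
      simp only [Fin.lt_def] at hj
      omega
    · obtain ⟨M, hM, hle⟩ := exists_max hi (before a i)
      have hp : IsNoncrossingRGF (before a i) := ha.comp_castLE i.2.le
      rw [asc_eq_of_isNoncrossingRGF hp hM hle]
      by_contra h
      obtain ⟨j, hj, hjv⟩ := ha.exists_lt i (M + 1) (by omega)
      have : a j ≤ M := hle ⟨j, hj⟩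
      omega

/-! ### The poset of a sequence -/

/-- Position `i` precedes every occurrence of the value at position `j`. -/
def Prec {n : ℕ} (a : Fin n → ℕ) (i j : Fin n) : Prop := ∀ k, a k = a j → i < k

theorem Prec.lt {n : ℕ} {a : Fin n → ℕ} {i j : Fin n} (h : Prec a i j) : i < j := h j rfl

/-- The partial order whose strict relation is `Prec a`. -/
@[reducible] def precOrder {n : ℕ} (a : Fin n → ℕ) : PartialOrder (Fin n) where
  le i j := i = j ∨ Prec a i j
  lt i j := Prec a i j
  lt_iff_le_not_ge i j := by
    constructor
    · intro h
      refine ⟨Or.inr h, ?_⟩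
      rintro (rfl | h')
      · exact lt_irrefl _ h.lt
      · exact lt_asymm h.lt h'.lt
    · rintro ⟨rfl | h, h'⟩
      · exact absurd (Or.inl rfl) h'
      · exact h
  le_refl i := Or.inl rfl
  le_trans i j k := by
    rintro (rfl | h₁) (rfl | h₂)
    · exact Or.inl rfl
    · exact Or.inr h₂
    · exact Or.inr h₁
    · exact Or.inr fun l hl => h₁.lt.trans (h₂ l hl)
  le_antisymm i j := by
    rintro (rfl | h₁) (h₂ | h₂)
    · rfl
    · rfl
    · exact h₂.symm
    · exact absurd h₂.lt (lt_asymm h₁.lt)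

/-- The bijection `e` identifies `P` with the poset of the sequence `a`. -/
def Realizes {n : ℕ} {α : Type} (P : PartialOrder α) (a : Fin n → ℕ) (e : Fin n ≃ α) : Prop :=
  ∀ i j, Prec a i j ↔ e i < e j

theorem realizes_precOrder {n : ℕ} (a : Fin n → ℕ) :
    Realizes (precOrder a) a (Equiv.refl _) := fun _ _ => Iff.rfl

theorem isom_iff {α β : Type} (P : PartialOrder α) (Q : PartialOrder β) :
    Isom P Q ↔ ∃ e : α ≃ β, ∀ x y, x < y ↔ e x < e y := by
  constructor
  · rintro ⟨e⟩
    exact ⟨e.toEquiv, fun x y => e.lt_iff_lt.symm⟩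
  · rintro ⟨e, he⟩
    refine ⟨⟨e, fun {x y} => ?_⟩⟩
    rw [le_iff_lt_or_eq, le_iff_lt_or_eq, he, e.injective.eq_iff]

theorem unlabel_precOrder_eq_iff {n : ℕ} (a : Fin n → ℕ) (P : PartialOrder (Fin n)) :
    unlabel (precOrder a) = unlabel P ↔ ∃ e, Realizes P a e := by
  exact Quotient.eq.trans (isom_iff _ _)

theorem incomp_iff {α : Type} (P : PartialOrder α) (x y : α) :
    Incomp P x y ↔ x ≠ y ∧ ¬ x < y ∧ ¬ y < x := by
  simp only [Incomp, le_iff_lt_or_eq]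
  grind

/-! ### Levels of the poset of a sequence -/

/-- The positions that precede every occurrence of `v`. -/
def precValue {n : ℕ} (a : Fin n → ℕ) (v : ℕ) : Set (Fin n) := {i | ∀ k, a k = v → i < k}

/-- The first occurrence of `v` precedes every `w` but not itself. Only the growth condition is
assumed, because the lemma also serves to prove noncrossing in
`IsNoncrossingRGF.of_realizes_of_nFree`. -/
theorem precValue_ssubset {n : ℕ} {a : Fin n → ℕ}
    (ha : ∀ i v, v < a i → ∃ j < i, a j = v) {v w : ℕ} (hvw : v < w) (hw : ∃ i, a i = w) :
    precValue a v ⊂ precValue a w := by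
  have hv : ∃ i, a i = v := by
    obtain ⟨i, rfl⟩ := hw
    obtain ⟨j, -, hj⟩ := ha i v hvw
    exact ⟨j, hj⟩
  obtain ⟨m, hm, hmin⟩ := Set.exists_min_image {i | a i = v} id (Set.toFinite _) hv
  refine ⟨fun i hi k hk => ?_, fun hsub => ?_⟩
  · obtain ⟨l, hl, hlv⟩ := ha k v (hk ▸ hvw)
    exact (hi l hlv).trans hl
  · refine lt_irrefl m (hsub (fun k hk => ?_) m hm)
    obtain ⟨l, hl, hlv⟩ := ha k v (hk ▸ hvw)
    exact (hmin l hlv).trans_lt hl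

section Levels

variable {n : ℕ} {α : Type} {P : PartialOrder α} {a : Fin n → ℕ} {e : Fin n ≃ α}

theorem Realizes.Iio_eq (he : Realizes P a e) (j : Fin n) :
    Set.Iio (e j) = e '' precValue a (a j) := by
  ext x
  obtain ⟨i, rfl⟩ := e.surjective x
  rw [Set.mem_Iio, ← he, e.injective.mem_set_image]
  rfl

theorem image_precValue_ssubset (ha : IsNoncrossingRGF a) {v w : ℕ} (hvw : v < w)
    (hw : ∃ i, a i = w) : e '' precValue a v ⊂ e '' precValue a w :=
  e.injective.image_strictMono (precValue_ssubset ha.exists_lt hvw hw)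

theorem image_precValue_ssubset_iff (ha : IsNoncrossingRGF a) {v w : ℕ} (hv : ∃ i, a i = v)
    (hw : ∃ i, a i = w) : e '' precValue a v ⊂ e '' precValue a w ↔ v < w := by
  refine ⟨fun h => ?_, fun h => image_precValue_ssubset ha h hw⟩
  rcases lt_trichotomy v w with h' | rfl | h'
  · exact h'
  · exact absurd h (ssubset_irrefl _)
  · exact absurd h (ssubset_asymm (image_precValue_ssubset ha h' hv))

theorem image_precValue_injOn (ha : IsNoncrossingRGF a) :
    Set.InjOn (fun v => e '' precValue a v) (Set.range a) := by
  intro v hv w hw h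
  rcases lt_trichotomy v w with h' | h' | h'
  · exact absurd h (image_precValue_ssubset ha h' hw).ne
  · exact h'
  · exact absurd h.symm (image_precValue_ssubset ha h' hv).ne

theorem Realizes.level_eq (he : Realizes P a e) (ha : IsNoncrossingRGF a) (j : Fin n) :
    level P (e j) = a j := by
  have hset : {D : Set α | D ∈ Set.range (fun y : α => Set.Iio y) ∧ D ⊂ Set.Iio (e j)} =
      (fun v => e '' precValue a v) '' (Finset.range (a j) : Set ℕ) := by
    ext D
    simp only [Set.mem_ofPred_eq, Set.mem_range, Set.mem_image, Finset.coe_range, Set.mem_Iio]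
    constructor
    · rintro ⟨⟨x, rfl⟩, h⟩
      obtain ⟨i, rfl⟩ := e.surjective x
      rw [he.Iio_eq, he.Iio_eq, image_precValue_ssubset_iff ha ⟨i, rfl⟩ ⟨j, rfl⟩] at h
      exact ⟨a i, h, (he.Iio_eq i).symm⟩
    · rintro ⟨v, hv, rfl⟩
      obtain ⟨i, -, rfl⟩ := ha.exists_lt j v hv
      rw [he.Iio_eq, image_precValue_ssubset_iff ha ⟨i, rfl⟩ ⟨j, rfl⟩]
      exact ⟨⟨e i, he.Iio_eq i⟩, hv⟩
  rw [level, hset, Set.InjOn.ncard_image, Set.ncard_coe_finset, Finset.card_range]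
  refine (image_precValue_injOn ha).mono fun v hv => ?_
  obtain ⟨i, -, hi⟩ := ha.exists_lt j v (by simpa using hv)
  exact ⟨i, hi⟩

theorem Realizes.ell_eq (he : Realizes P a e) (ha : IsNoncrossingRGF a) {M : ℕ}
    (hM : ∃ i, a i = M) (hle : ∀ i, a i ≤ M) : ell P = M := by
  have hocc : ∀ v ≤ M, ∃ i, a i = v := by
    intro v hv
    obtain ⟨m, rfl⟩ := hM
    rcases hv.lt_or_eq with h | h
    · obtain ⟨i, -, hi⟩ := ha.exists_lt m v h
      exact ⟨i, hi⟩
    · exact ⟨m, h.symm⟩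
  have hempty : e '' precValue a 0 = ∅ := by
    rw [Set.image_eq_empty, Set.eq_empty_iff_forall_notMem]
    intro i hi
    have h0 : a ⟨0, i.pos⟩ = 0 := by
      by_contra h
      obtain ⟨j, hj, -⟩ := ha.exists_lt ⟨0, i.pos⟩ 0 (by omega)
      exact Nat.not_lt_zero _ hj
    exact Nat.not_lt_zero _ (hi _ h0)
  have hset : {D : Set α | D ∈ Set.range (fun y : α => Set.Iio y) ∧ D.Nonempty} =
      (fun v => e '' precValue a v) '' (Finset.Icc 1 M : Set ℕ) := by
    ext D
    simp only [Set.mem_ofPred_eq, Set.mem_range, Set.mem_image, Finset.coe_Icc, Set.mem_Icc]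
    constructor
    · rintro ⟨⟨x, rfl⟩, h⟩
      obtain ⟨i, rfl⟩ := e.surjective x
      rw [he.Iio_eq] at h
      refine ⟨a i, ⟨Nat.one_le_iff_ne_zero.2 fun h0 => ?_, hle i⟩, (he.Iio_eq i).symm⟩
      rw [h0, hempty] at h
      exact Set.not_nonempty_empty h
    · rintro ⟨v, ⟨hv, hvM⟩, rfl⟩
      obtain ⟨i, rfl⟩ := hocc v hvM
      refine ⟨⟨e i, he.Iio_eq i⟩, ?_⟩
      have := image_precValue_ssubset (e := e) ha (show 0 < a i by omega) ⟨i, rfl⟩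
      rw [hempty] at this
      exact Set.empty_ssubset.1 this
  rw [ell, hset, Set.InjOn.ncard_image, Set.ncard_coe_finset, Nat.card_Icc]
  · rfl
  · refine (image_precValue_injOn ha).mono fun v hv => ?_
    exact hocc v (Finset.mem_Icc.1 hv).2

end Levels

theorem Realizes.not_last_lt {n : ℕ} {α : Type} {P : PartialOrder α} {a : Fin (n + 1) → ℕ}
    {e : Fin (n + 1) ≃ α} (he : Realizes P a e) (x : α) : ¬ e (Fin.last n) < x := by
  obtain ⟨j, rfl⟩ := e.surjective x
  rw [← he]
  exact fun h => absurd h.lt (not_lt.2 (Fin.le_last j))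

/-- The last position is maximal. If `i` is maximal with a smaller value, then `i` does not precede
every copy of the last value, so a copy before `i` completes a `101` with `i` and the last entry. -/
theorem Realizes.ellStar_eq {n : ℕ} {α : Type} {P : PartialOrder α} {a : Fin (n + 1) → ℕ}
    {e : Fin (n + 1) ≃ α} (he : Realizes P a e) (ha : IsNoncrossingRGF a) :
    ellStar P = a (Fin.last n) := by
  have hmem : a (Fin.last n) ∈ {i : ℕ | ∃ x : α, IsMax x ∧ level P x = i} := by
    refine ⟨e (Fin.last n), ?_, he.level_eq ha _⟩
    rw [isMax_iff_forall_not_lt]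
    exact he.not_last_lt
  refine le_antisymm (Nat.sInf_le hmem) (le_csInf ⟨_, hmem⟩ ?_)
  rintro _ ⟨x, hx, rfl⟩
  obtain ⟨i, rfl⟩ := e.surjective x
  rw [he.level_eq ha]
  by_contra hlt
  rw [isMax_iff_forall_not_lt] at hx
  have := hx (e (Fin.last n))
  rw [← he, Prec] at this
  push Not at this
  obtain ⟨k, hk, hki⟩ := this
  have hki' : k < i := lt_of_le_of_ne hki (by rintro rfl; omega)
  have hil : i < Fin.last n := lt_of_le_of_ne (Fin.le_last i) (by rintro rfl; omega)
  exact hlt (ha.le_of_between k i _ hki' hil hk)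

/-- The value must occur: for an absent `v` the left side is empty, whereas `precValue a v` is
vacuously everything. -/
theorem Realizes.belowLevel_eq {n : ℕ} {α : Type} {P : PartialOrder α} {a : Fin n → ℕ}
    {e : Fin n ≃ α} (he : Realizes P a e) (ha : IsNoncrossingRGF a) {v : ℕ}
    (hv : ∃ i, a i = v) : belowLevel P v = e '' precValue a v := by
  obtain ⟨j, rfl⟩ := hv
  rw [← he.Iio_eq]
  ext x
  constructor
  · rintro ⟨z, hz, hxz⟩
    obtain ⟨k, rfl⟩ := e.surjective z
    rw [he.level_eq ha] at hz
    rw [he.Iio_eq, ← hz, ← he.Iio_eq]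
    exact hxz
  · exact fun hx => ⟨e j, he.level_eq ha j, hx⟩

/-! ### The construction yields the poset of the sequence -/

theorem prec_castSucc_iff {n : ℕ} (a : Fin (n + 1) → ℕ) (i j : Fin n) :
    Prec a i.castSucc j.castSucc ↔ Prec (fun i => a i.castSucc) i j := by
  constructor
  · exact fun h k hk => h k.castSucc hk
  · intro h k hk
    induction k using Fin.lastCases with
    | last => exact Fin.castSucc_lt_last i
    | cast k => exact h k hk

theorem not_prec_last {n : ℕ} (a : Fin (n + 1) → ℕ) (i : Fin (n + 1)) :
    ¬ Prec a (Fin.last n) i :=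
  fun h => absurd h.lt (not_lt.2 (Fin.le_last i))

theorem prec_castSucc_last_iff {n : ℕ} (a : Fin (n + 1) → ℕ) (i : Fin n) :
    Prec a i.castSucc (Fin.last n) ↔
      i ∈ precValue (fun i => a i.castSucc) (a (Fin.last n)) := by
  constructor
  · exact fun h k hk => h k.castSucc hk
  · intro h k hk
    induction k using Fin.lastCases with
    | last => exact Fin.castSucc_lt_last i
    | cast k => exact h k hk

theorem partialOrder_ext_lt {α : Type} {P Q : PartialOrder α}
    (h : ∀ x y, P.lt x y ↔ Q.lt x y) : P = Q := by
  refine PartialOrder.ext fun x y => ?_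
  have hP : P.le x y ↔ P.lt x y ∨ x = y := @le_iff_lt_or_eq _ P x y
  have hQ : Q.le x y ↔ Q.lt x y ∨ x = y := @le_iff_lt_or_eq _ Q x y
  exact hP.trans ((or_congr_left (h x y)).trans hQ.symm)

/-- Serves rules 1 and 2 at once. The set `S` is kept general, tied by an equation, so that no
rewriting under the proof `hS` is needed. -/
theorem lift_addMax_eq_precOrder {n : ℕ} (a : Fin (n + 1) → ℕ) (S : Set (Fin n))
    (hS : @IsLowerSet _ (precOrder fun i => a i.castSucc).toLE S)
    (h : S = precValue (fun i => a i.castSucc) (a (Fin.last n))) :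
    @PartialOrder.lift _ _ (addMax (precOrder fun i => a i.castSucc) S hS) finSuccEquivLast
      finSuccEquivLast.injective = precOrder a := by
  subst h
  refine partialOrder_ext_lt fun x y => ?_
  change (addMax (precOrder fun i => a i.castSucc) _ hS).lt (finSuccEquivLast x) (finSuccEquivLast y) ↔ Prec a x y
  induction x using Fin.lastCases with
  | last =>
    rw [finSuccEquivLast_last]
    exact iff_of_false id (not_prec_last a y)
  | cast x =>
    rw [finSuccEquivLast_castSucc]
    induction y using Fin.lastCases with
    | last =>
      rw [finSuccEquivLast_last]
      exact (prec_castSucc_last_iff a x).symm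
    | cast y =>
      rw [finSuccEquivLast_castSucc]
      exact (prec_castSucc_iff a x y).symm

theorem IsNoncrossingRGF.castSucc {n : ℕ} {a : Fin (n + 1) → ℕ} (ha : IsNoncrossingRGF a) :
    IsNoncrossingRGF (fun i : Fin n => a i.castSucc) := ha.comp_castLE (Nat.le_succ n)

/-- A last entry seen before is at most the entry preceding it, by noncrossing, which is rule 1; an
unseen one is `M + 1`, which is rule 2. -/
theorem apLabelled_eq : ∀ (n : ℕ) (a : Fin (n + 1) → ℕ), IsNoncrossingRGF a →
    apLabelled (n + 1) a = precOrder a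
  | 0, a, _ => by
    have : Subsingleton (Fin (0 + 1)) := inferInstanceAs (Subsingleton (Fin 1))
    refine partialOrder_ext_lt fun x y => iff_of_false ?_ ?_
    · rw [Subsingleton.elim x y]
      exact @lt_irrefl _ (apLabelled 1 a).toPreorder y
    · rw [Subsingleton.elim x y]
      exact fun h => lt_irrefl _ h.lt
  | n + 1, a, ha => by
    have hp := ha.castSucc
    have hr := realizes_precOrder fun i : Fin (n + 1) => a i.castSucc
    rw [apLabelled, apLabelled_eq n _ hp]
    by_cases hc : ∃ i : Fin (n + 1), a i.castSucc = a (Fin.last (n + 1))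
    · have hle : a (Fin.last (n + 1)) ≤ ellStar (precOrder fun i : Fin (n + 1) => a i.castSucc) := by
        rw [hr.ellStar_eq hp]
        obtain ⟨i, hi⟩ := hc
        rcases (Fin.le_last i).lt_or_eq with h | rfl
        · exact ha.le_of_between i.castSucc _ _ h (Fin.castSucc_lt_last _) hi
        · exact hi.ge
      rw [apStep, if_pos hle]
      refine lift_addMax_eq_precOrder a _ _ ?_
      rw [hr.belowLevel_eq hp hc]
      simp
    · have hgt : ∀ i : Fin (n + 1), a i.castSucc < a (Fin.last (n + 1)) := by
        intro i
        by_contra h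
        rcases (not_lt.1 h).lt_or_eq with h | h
        · obtain ⟨j, -, hj⟩ := hp.exists_lt i _ h
          exact hc ⟨j, hj⟩
        · exact hc ⟨i, h.symm⟩
      obtain ⟨M, ⟨m, hm⟩, hle⟩ := exists_max n.succ_pos fun i : Fin (n + 1) => a i.castSucc
      have hM : a (Fin.last (n + 1)) = M + 1 := by
        refine le_antisymm (not_lt.1 fun h => ?_) (hm ▸ hgt m)
        obtain ⟨j, hj, hjM⟩ := ha.exists_lt _ _ h
        induction j using Fin.lastCases with
        | last => exact lt_irrefl _ hj
        | cast j => exact absurd (hle j) (by simp only [hjM]; omega)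
      rw [apStep, if_neg (by rw [hr.ellStar_eq hp]; exact not_le.2 (hgt _)),
        if_pos (by rw [hr.ell_eq hp ⟨m, hm⟩ hle, hM])]
      refine lift_addMax_eq_precOrder a _ _ ?_
      -- The new value has no earlier occurrence, so every position precedes all of them.
      exact (Set.eq_univ_of_forall fun i k hk => absurd ⟨k, hk⟩ hc).symm

/-! ### The image consists of series-parallel interval orders -/

/-- Of the two lower elements, the one at the earlier position is also below the other's upper
element. -/
theorem Realizes.twoPlusTwoFree {n : ℕ} {α : Type} {P : PartialOrder α} {a : Fin n → ℕ}
    {e : Fin n ≃ α} (he : Realizes P a e) : TwoPlusTwoFree P := by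
  rintro ⟨w, x, y, z, hwx, hyz, -, hwz, hxy, -⟩
  obtain ⟨w, rfl⟩ := e.surjective w
  obtain ⟨x, rfl⟩ := e.surjective x
  obtain ⟨y, rfl⟩ := e.surjective y
  obtain ⟨z, rfl⟩ := e.surjective z
  rw [← he] at hwx hyz
  rw [incomp_iff, ← he] at hwz hxy
  rw [← he] at hxy
  rcases le_total w y with h | h
  · exact hwz.2.1 fun k hk => h.trans_lt (hyz k hk)
  · exact hxy.2.2 fun k hk => h.trans_lt (hwx k hk)

theorem Realizes.nFree {n : ℕ} {α : Type} {P : PartialOrder α} {a : Fin n → ℕ}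
    {e : Fin n ≃ α} (he : Realizes P a e) (ha : IsNoncrossingRGF a) : NFree P := by
  rintro ⟨w, x, y, z, hwz, hxz, hxy, hwx, hwy, hyz⟩
  obtain ⟨w, rfl⟩ := e.surjective w
  obtain ⟨x, rfl⟩ := e.surjective x
  obtain ⟨y, rfl⟩ := e.surjective y
  obtain ⟨z, rfl⟩ := e.surjective z
  rw [incomp_iff, ← he, ← he] at hwx hwy hyz
  rw [← he] at hwz hxz hxy
  have hxw := hwx.2.2
  have hwy' := hwy.2.1
  have hyz' := hyz.2.1
  simp only [Prec] at hxw hwy' hyz'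
  push Not at hxw hwy' hyz'
  obtain ⟨i, hi, hix⟩ := hxw
  obtain ⟨j, hj, hjw⟩ := hwy'
  obtain ⟨k, hk, hky⟩ := hyz'
  -- Otherwise the value `a y` would occur no later than `i ≤ x`, against `x` preceding all its
  -- occurrences. Then `j < w < k ≤ y` makes `j, w, y` a `101`.
  have hlt : a w < a y := by
    by_contra h
    rcases (not_lt.1 h).lt_or_eq with h | h
    · obtain ⟨l, hl, hly⟩ := ha.exists_lt i (a y) (hi ▸ h)
      exact absurd (hxy l hly) (not_lt.2 (hl.le.trans hix))
    · exact absurd (hxy i (hi.trans h.symm)) (not_lt.2 hix)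
  have hjw' : j < w := lt_of_le_of_ne hjw (by rintro rfl; omega)
  have := ha.le_of_between j w y hjw' ((hwz k hk).trans_le hky) hj
  omega

/-! ### Injectivity -/

/-- Maximal elements on the same level are twins, so exchanging them is an automorphism. -/
theorem prec_swap_iff {n : ℕ} {b : Fin n → ℕ} {x y : Fin n} (hxy : b x = b y)
    (hx : ∀ i, ¬ Prec b x i) (hy : ∀ i, ¬ Prec b y i) (i j : Fin n) :
    Prec b (Equiv.swap x y i) (Equiv.swap x y j) ↔ Prec b i j := by
  have hj : b (Equiv.swap x y j) = b j := by
    rw [Equiv.swap_apply_def]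
    split_ifs with h1 h2
    · rw [h1, hxy]
    · rw [h2, hxy]
    · rfl
  have h1 : ∀ i, Prec b i (Equiv.swap x y j) ↔ Prec b i j := fun i => by rw [Prec, Prec, hj]
  rw [h1, Equiv.swap_apply_def]
  split_ifs with h2 h3
  · rw [h2]
    exact iff_of_false (hy j) (hx j)
  · rw [h3]
    exact iff_of_false (hx j) (hy j)
  · rfl

/-- The last entry is an invariant of the poset, namely `ellStar`. The last position and its image
are maximal on that level, so a swap lets the isomorphism fix the last position and restrict to the
prefixes. -/
theorem eq_of_realizes : ∀ (n : ℕ) (a b : Fin n → ℕ), IsNoncrossingRGF a → IsNoncrossingRGF b →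
    ∀ e : Fin n ≃ Fin n, Realizes (precOrder b) a e → a = b
  | 0, _, _, _, _, _, _ => Subsingleton.elim _ _
  | n + 1, a, b, ha, hb, e, he => by
    have hr := realizes_precOrder b
    have hlast : a (Fin.last n) = b (Fin.last n) := by
      rw [← he.ellStar_eq ha, hr.ellStar_eq hb]
    have hval : b (e (Fin.last n)) = b (Fin.last n) := by
      rw [← hlast, ← he.level_eq ha]
      exact (hr.level_eq hb _).symm
    set s : Fin (n + 1) ≃ Fin (n + 1) := e.trans (Equiv.swap (e (Fin.last n)) (Fin.last n))
      with hs
    have hsl : s (Fin.last n) = Fin.last n := by simp [hs]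
    have hsP : ∀ i j, Prec a i j ↔ Prec b (s i) (s j) := fun i j =>
      (he i j).trans (prec_swap_iff hval (fun k => he.not_last_lt k) (not_prec_last b) _ _).symm
    -- On `Option`, `Equiv.removeNone` deletes the fixed last position.
    set t : Option (Fin n) ≃ Option (Fin n) :=
      (finSuccEquivLast.symm.trans s).trans finSuccEquivLast with ht
    have htn : t none = none := by simp [ht, hsl]
    have htc : ∀ i : Fin n, (Equiv.removeNone t i).castSucc = s i.castSucc := by
      intro i
      have h1 : some (Equiv.removeNone t i) = t (some i) := by
        refine Equiv.removeNone_some t ?_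
        have : t (some i) ≠ none := fun h => by
          simpa using t.injective (h.trans htn.symm)
        exact Option.ne_none_iff_exists'.1 this
      have h2 := congrArg finSuccEquivLast.symm h1
      simpa [ht] using h2
    have hpre := eq_of_realizes n _ _ ha.castSucc hb.castSucc (Equiv.removeNone t) fun i j => by
      rw [← prec_castSucc_iff, hsP, ← htc, ← htc, prec_castSucc_iff]
      rfl
    funext i
    induction i using Fin.lastCases with
    | last => exact hlast
    | cast i => exact congrFun hpre i

/-! ### Surjectivity -/

theorem Iio_subset_or_of_twoPlusTwoFree {α : Type} {P : PartialOrder α} (h : TwoPlusTwoFree P)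
    (x y : α) : Set.Iio x ⊆ Set.Iio y ∨ Set.Iio y ⊆ Set.Iio x := by
  by_contra hc
  push Not at hc
  obtain ⟨⟨u, hux, huy⟩, ⟨v, hvy, hvx⟩⟩ := And.intro (Set.not_subset.1 hc.1) (Set.not_subset.1 hc.2)
  simp only [Set.mem_Iio] at hux huy hvy hvx
  refine h ⟨u, x, v, y, hux, hvy, ⟨?_, ?_⟩, ⟨?_, ?_⟩, ⟨?_, ?_⟩, ⟨?_, ?_⟩⟩ <;> intro hle
  · exact huy (hle.trans_lt hvy)
  · exact hvx (hle.trans_lt hux)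
  · rcases hle.lt_or_eq with h | rfl
    · exact huy h
    · exact hvx (hvy.trans hux)
  · exact hvx (hvy.trans_le (hle.trans hux.le))
  · exact huy (hux.trans_le (hle.trans hvy.le))
  · rcases hle.lt_or_eq with h | rfl
    · exact hvx h
    · exact huy (hux.trans hvy)
  · exact huy (hux.trans_le hle)
  · exact hvx (hvy.trans_le hle)

/-- Strict downsets are nested, so least cardinality among maximal elements means least by
inclusion. -/
theorem exists_isMax_forall_Iio_subset {α : Type} [Finite α] [Nonempty α] {P : PartialOrder α}
    (h : TwoPlusTwoFree P) : ∃ x : α, IsMax x ∧ ∀ y : α, IsMax y → Set.Iio x ⊆ Set.Iio y := by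
  obtain ⟨m, hm⟩ : ∃ m : α, IsMax m := by
    obtain ⟨m, hm⟩ := Set.Finite.exists_maximal (Set.toFinite (Set.univ : Set α)) Set.univ_nonempty
    exact ⟨m, fun y hy => hm.2 trivial hy⟩
  obtain ⟨x, hx, hmin⟩ := Set.exists_min_image {x : α | IsMax x} (fun x => (Set.Iio x).ncard)
    (Set.toFinite _) ⟨m, hm⟩
  refine ⟨x, hx, fun y hy => ?_⟩
  rcases Iio_subset_or_of_twoPlusTwoFree h x y with hs | hs
  · exact hs
  · exact (Set.eq_of_subset_of_ncard_le hs (hmin y hy) (Set.toFinite _)).ge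

/-- Otherwise take `y` minimal among the elements other than `x` and not below `x`. Its downset lies
strictly inside that of `x`, so some `f < x` is not below `y`, and by `hmin` `y` is not maximal. A
maximal `z > y` is above `f` too, and `y < z > f < x` is an N. -/
theorem exists_twin_or_forall_lt {α : Type} [Finite α] {P : PartialOrder α}
    (h : NFree P) {x : α} (hx : IsMax x)
    (hmin : ∀ y : α, IsMax y → Set.Iio x ⊆ Set.Iio y) :
    (∃ y ≠ x, Set.Iio y = Set.Iio x) ∨ ∀ y ≠ x, y < x := by
  by_contra hc
  push Not at hc
  obtain ⟨hne, y₀, hy₀, hy₀x⟩ := hc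
  obtain ⟨y, ⟨hyx, hy⟩, hymin⟩ := Set.Finite.exists_minimal
    (Set.toFinite {y : α | y ≠ x ∧ ¬ y < x}) ⟨y₀, hy₀, hy₀x⟩
  have hsub : Set.Iio y ⊆ Set.Iio x := by
    intro w hw
    by_contra hwx
    have hwne : w ≠ x := by
      rintro rfl
      exact (isMax_iff_forall_not_lt.1 hx) y hw
    exact absurd hw (not_lt_of_ge (hymin ⟨hwne, hwx⟩ hw.le))
  obtain ⟨f, hfx, hfy⟩ := Set.exists_of_ssubset (hsub.ssubset_of_ne (hne y hyx))
  have hynmax : ¬ IsMax y := fun hm => hfy (hmin y hm hfx)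
  obtain ⟨z, hyz, hz⟩ : ∃ z, y < z ∧ IsMax z := by
    obtain ⟨w, hw⟩ := not_isMax_iff.1 hynmax
    obtain ⟨z, hwz, hz⟩ := Set.Finite.exists_le_maximal (Set.toFinite (Set.univ : Set α))
      (Set.mem_univ w)
    exact ⟨z, hw.trans_le hwz, fun v hv => hz.2 trivial hv⟩
  have hxz : x ≠ z := by
    rintro rfl
    exact hy hyz
  have hfz : f < z := hmin z hz hfx
  rw [isMax_iff_forall_not_lt] at hx hz
  refine h ⟨y, f, x, z, hyz, hfz, hfx, ?_, ?_, ?_⟩ <;> rw [incomp_iff]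
  · refine ⟨?_, fun h => hy (h.trans hfx), hfy⟩
    rintro rfl
    exact hy hfx
  · exact ⟨hyx, hy, hx y⟩
  · exact ⟨hxz, hx z, hz x⟩

/-- The extension of a labelling of the complement of `x` that gives `x` the last label. -/
def extendLabel {n : ℕ} {α : Type} [DecidableEq α] (x : α) (e : Fin n ≃ {y : α // y ≠ x}) :
    Fin (n + 1) ≃ α :=
  (finSuccEquivLast.trans e.optionCongr).trans (Equiv.optionSubtypeNe x)

theorem extendLabel_last {n : ℕ} {α : Type} [DecidableEq α] (x : α)
    (e : Fin n ≃ {y : α // y ≠ x}) : extendLabel x e (Fin.last n) = x := by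
  simp [extendLabel]

theorem extendLabel_castSucc {n : ℕ} {α : Type} [DecidableEq α] (x : α)
    (e : Fin n ≃ {y : α // y ≠ x}) (i : Fin n) : extendLabel x e i.castSucc = e i := by
  simp [extendLabel]

theorem realizes_extendLabel {n : ℕ} {α : Type} [DecidableEq α] {P : PartialOrder α} {x : α}
    (hx : IsMax x) {a : Fin (n + 1) → ℕ} {e : Fin n ≃ {y : α // y ≠ x}}
    (he : ∀ i j, Prec (fun i : Fin n => a i.castSucc) i j ↔ (e i : α) < e j)
    (hlast : ∀ i, i ∈ precValue (fun i : Fin n => a i.castSucc) (a (Fin.last n)) ↔ (e i : α) < x) :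
    Realizes P a (extendLabel x e) := by
  intro i j
  induction i using Fin.lastCases with
  | last =>
    rw [extendLabel_last]
    exact iff_of_false (not_prec_last a j) (isMax_iff_forall_not_lt.1 hx _)
  | cast i =>
    rw [extendLabel_castSucc]
    induction j using Fin.lastCases with
    | last => rw [extendLabel_last, prec_castSucc_last_iff, hlast]
    | cast j => rw [extendLabel_castSucc, prec_castSucc_iff, he]

/-- A new `101` must end at the last position, with middle `j`. Some `f` is below the last element
but not below `j`; so `j` is not maximal, some `z` is above it, and `j < z > f < last` is an N. -/
theorem IsNoncrossingRGF.of_realizes_of_nFree {n : ℕ} {α : Type} {P : PartialOrder α}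
    (hN : NFree P) {a : Fin (n + 1) → ℕ} {e : Fin (n + 1) ≃ α} (he : Realizes P a e)
    (hmin : ∀ y : α, IsMax y → Set.Iio (e (Fin.last n)) ⊆ Set.Iio y)
    (hp : IsNoncrossingRGF fun i : Fin n => a i.castSucc)
    (ha : ∀ v < a (Fin.last n), ∃ j : Fin n, a j.castSucc = v) : IsNoncrossingRGF a := by
  have hrgf : ∀ i v, v < a i → ∃ j < i, a j = v := by
    intro i v hv
    induction i using Fin.lastCases with
    | last =>
      obtain ⟨j, hj⟩ := ha v hv
      exact ⟨j.castSucc, Fin.castSucc_lt_last j, hj⟩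
    | cast i =>
      obtain ⟨j, hj, hjv⟩ := hp.exists_lt i v hv
      exact ⟨j.castSucc, hj, hjv⟩
  refine ⟨hrgf, fun i j k hij hjk hik => ?_⟩
  induction k using Fin.lastCases with
  | cast k =>
    exact hp.le_of_between ⟨i, lt_trans (hij.trans hjk) k.2⟩ ⟨j, lt_trans hjk k.2⟩ k hij hjk hik
  | last =>
    by_contra hlt
    obtain ⟨f, hf, hfj⟩ := Set.exists_of_ssubset
      (precValue_ssubset hrgf (not_le.1 hlt) ⟨Fin.last n, rfl⟩)
    have hjmax : ¬ IsMax (e j) := fun hm => by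
      have := hmin _ hm
      rw [he.Iio_eq, he.Iio_eq, Set.image_subset_image_iff e.injective] at this
      exact hfj (this hf)
    obtain ⟨z, hz⟩ := not_isMax_iff.1 hjmax
    obtain ⟨z, rfl⟩ := e.surjective z
    have hjz : Prec a j z := (he j z).2 hz
    have hfi : f < i := hf i hik
    have hjl : ¬ Prec a j (Fin.last n) := fun h => lt_asymm (h i hik) hij
    refine hN ⟨e j, e f, e (Fin.last n), e z, hz, ?_, ?_, ?_, ?_, ?_⟩
    · exact (he _ _).1 fun k hk => (hfi.trans hij).trans (hjz k hk)
    · exact (he _ _).1 hf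
    all_goals rw [incomp_iff, ← he, ← he, e.injective.ne_iff]
    · exact ⟨(hfi.trans hij).ne', fun h => lt_asymm h.lt (hfi.trans hij), hfj⟩
    · exact ⟨hjk.ne, hjl, not_prec_last a j⟩
    · refine ⟨?_, not_prec_last a z, fun h => ?_⟩
      · rintro rfl
        exact hjl hjz
      · exact lt_asymm (h i hik) (hij.trans hjz.lt)

theorem TwoPlusTwoFree.subtype {α : Type} {P : PartialOrder α} (h : TwoPlusTwoFree P)
    (p : α → Prop) : TwoPlusTwoFree (Subtype.partialOrder p) := by
  rintro ⟨w, x, y, z, hs⟩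
  exact h ⟨w, x, y, z, hs⟩

theorem NFree.subtype {α : Type} {P : PartialOrder α} (h : NFree P)
    (p : α → Prop) : NFree (Subtype.partialOrder p) := by
  rintro ⟨w, x, y, z, hs⟩
  exact h ⟨w, x, y, z, hs⟩

/-- Stated for all finite types because the induction passes to the subtype without `x`. -/
theorem exists_realizes : ∀ (n : ℕ) (α : Type) [Finite α] (P : PartialOrder α), Nat.card α = n →
    TwoPlusTwoFree P → NFree P → ∃ (a : Fin n → ℕ) (e : Fin n ≃ α),
      IsNoncrossingRGF a ∧ Realizes P a e
  | 0, α, _, P, hcard, _, _ => by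
    refine ⟨fun _ => 0, (Finite.equivFinOfCardEq hcard).symm, ⟨?_, ?_⟩, ?_⟩ <;>
      exact fun i => i.elim0
  | n + 1, α, _, P, hcard, h₁, h₂ => by
    classical
    have : Nonempty α := (Finite.equivFinOfCardEq hcard).nonempty
    obtain ⟨x, hx, hmin⟩ := exists_isMax_forall_Iio_subset h₁
    have hcard' : Nat.card {y : α // y ≠ x} = n := by
      have := Finite.card_option (α := {y : α // y ≠ x})
      rw [Nat.card_congr (Equiv.optionSubtypeNe x), hcard] at this
      omega
    obtain ⟨a, e, ha, he⟩ := exists_realizes n {y : α // y ≠ x} (Subtype.partialOrder _) hcard'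
      (h₁.subtype _) (h₂.subtype _)
    -- An entry `c` may be appended for `x` if the positions preceding all copies of `c` are the
    -- elements below `x` and no value below `c` is missing. A twin supplies its own value; a top
    -- element takes the first unused one.
    have key : ∀ c : ℕ, (∀ i, i ∈ precValue a c ↔ (e i : α) < x) → (∀ v < c, ∃ j, a j = v) →
        ∃ (a : Fin (n + 1) → ℕ) (e : Fin (n + 1) ≃ α), IsNoncrossingRGF a ∧ Realizes P a e := by
      intro c hc hv
      have hr : Realizes P (Fin.snoc a c : Fin (n + 1) → ℕ) (extendLabel x e) :=
        realizes_extendLabel hx (by simp only [Fin.snoc_castSucc]; exact he) (by simpa using hc)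
      refine ⟨_, _, IsNoncrossingRGF.of_realizes_of_nFree h₂ hr ?_ ?_ ?_, hr⟩
      · rwa [extendLabel_last]
      · simpa using ha
      · simpa using hv
    rcases exists_twin_or_forall_lt h₂ hx hmin with ⟨y, hyx, hy⟩ | htop
    · obtain ⟨j, hj⟩ := e.surjective ⟨y, hyx⟩
      refine key (a j) (fun i => ?_) fun v hv => ?_
      · have h3 : (e i : α) < y ↔ (e i : α) < x := by
          rw [← Set.mem_Iio, hy, Set.mem_Iio]
        rw [← h3]
        have h4 := he i j
        rw [hj] at h4
        exact h4
      · obtain ⟨k, -, hk⟩ := ha.exists_lt j v hv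
        exact ⟨k, hk⟩
    · rcases Nat.eq_zero_or_pos n with rfl | hn
      · exact key 0 (fun i => i.elim0) fun v hv => absurd hv (Nat.not_lt_zero v)
      · obtain ⟨M, ⟨m, hm⟩, hle⟩ := exists_max hn a
        refine key (M + 1) (fun i => iff_of_true (fun k hk => ?_) (htop _ (e i).2)) fun v hv => ?_
        · have := hle k
          omega
        · rcases (Nat.lt_succ_iff.1 hv).lt_or_eq with h | h
          · obtain ⟨k, -, hk⟩ := ha.exists_lt m v (hm ▸ h)
            exact ⟨k, hk⟩
          · exact ⟨m, hm.trans h.symm⟩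

/-! ### Assembling the bijection -/

theorem fAP_eq {n : ℕ} (hn : 1 ≤ n) {a : Fin n → ℕ} (ha : IsNoncrossingRGF a) :
    fAP n a = unlabel (precOrder a) := by
  obtain ⟨n, rfl⟩ := Nat.exists_eq_add_of_le' hn
  rw [fAP, apLabelled_eq n a ha]

end AscPoset

theorem mainTheorem5 (n : ℕ) (hn : 1 ≤ n) :
    Set.BijOn (AscPoset.fAP n) (AscPoset.CAsc n) (AscPoset.CPosets n) := by
  open AscPoset in
  refine ⟨fun a ha => ?_, fun a ha b hb hab => ?_, ?_⟩
  · rw [mem_CAsc_iff] at ha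
    rw [fAP_eq hn ha]
    exact ⟨precOrder a, (realizes_precOrder a).twoPlusTwoFree, (realizes_precOrder a).nFree ha, rfl⟩
  · rw [mem_CAsc_iff] at ha hb
    rw [fAP_eq hn ha, fAP_eq hn hb, unlabel_precOrder_eq_iff] at hab
    obtain ⟨e, he⟩ := hab
    exact eq_of_realizes n a b ha hb e he
  · rintro _ ⟨P, h₁, h₂, rfl⟩
    obtain ⟨a, e, ha, he⟩ := exists_realizes n (Fin n) P (Nat.card_fin n) h₁ h₂
    refine ⟨a, (mem_CAsc_iff a).2 ha, ?_⟩
    rw [fAP_eq hn ha, unlabel_precOrder_eq_iff]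
    exact ⟨e, he⟩
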